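/- Let $k$ be a field of characteristic zero and let $W$ be a non-singular separated scheme of finite type over $k$ (non-singular means that all local rings are regular). Let $\mathcal I\subseteq\mathcal O_W$ be a (quasi-coherent) sheaf of ideals and let $\Pi:W'\to W$ be a log-resolution of $\mathcal I$, that is, a proper birational morphism such that: (i) $W'$ is non-singular; (ii) with $U=W\setminus\operatorname{Supp}(\mathcal I)$, where $\operatorname{Supp}(\mathcal I)$ is the support of $\mathcal O_W/\mathcal I$, and $U'=\Pi^{-1}(U)$, the morphism $\Pi$ restricts to an isomorphism $U'\to U$; (iii) $W'\setminus U'=H_1\cup\cdots\cup H_r$ is a simple normal crossings divisor, i.e. the $H_i$ are irreducible closed subsets and every local ring $\mathcal O_{W',y}$ has a regular system of parameters such that the stalks at $y$ of the (reduced) ideals $\mathbf I(H_i)$ of those $H_i$ passing through $y$ are generated by distinct members of it; (iv) $\mathcal I\mathcal O_{W'}=\mathbf I(H_1)^{a_1}\cdots\mathbf I(H_r)^{a_r}$ for some integers $a_i\ge 0$. Then for every integer $m\geq 1$ $$\overline{\mathcal I^{m}}=\bigl(\mathbf I(H_1)^{ma_1}\cdots\mathbf I(H_r)^{ma_r}\bigr)\cap\mathcal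 O_W .$$ Here $\overline{\mathcal J}$ denotes the integral closure of a sheaf of ideals $\mathcal J\subseteq\mathcal O_W$, and $\mathcal K\cap\mathcal O_W$, for a sheaf of ideals $\mathcal K\subseteq\mathcal O_{W'}$, denotes the sheaf of ideals of those local sections of $\mathcal O_W$ whose pullback to $W'$ lies in $\mathcal K$. -/

import Mathlib

open AlgebraicGeometry CategoryTheory TopologicalSpace

universe u

namespace LogRes

section IntegralClosure

/-- `x` is integral over the ideal `I`: it satisfies an equation
`x ^ n + a₁ x ^ (n - 1) + ⋯ + aₙ = 0` with `n ≥ 1` and `aᵢ ∈ I ^ i`. -/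
def IsIntegralOverIdeal {R : Type u} [CommRing R] (I : Ideal R) (x : R) : Prop :=
  ∃ n : ℕ, 0 < n ∧ ∃ a : ℕ → R, (∀ i, a i ∈ I ^ i) ∧
    x ^ n + ∑ i ∈ Finset.Icc 1 n, a i * x ^ (n - i) = 0

/-- `x` is integral over `I` iff `xT` is integral over the Rees algebra `R[IT] ⊆ R[T]`. -/
theorem isIntegralOverIdeal_iff {R : Type u} [CommRing R] (I : Ideal R) (x : R) :
    IsIntegralOverIdeal I x ↔ IsIntegral (reesAlgebra I) (Polynomial.monomial 1 x) := by
  constructor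
  · rintro ⟨n, hn, a, ha, h⟩
    have hm : ∀ i, Polynomial.monomial i (a i) ∈ reesAlgebra I := fun i =>
      reesAlgebra.monomial_mem.mpr (ha i)
    refine ⟨Polynomial.X ^ n + ∑ i ∈ Finset.Icc 1 n,
      Polynomial.C (⟨_, hm i⟩ : reesAlgebra I) * Polynomial.X ^ (n - i), ?_, ?_⟩
    · apply Polynomial.monic_X_pow_add
      refine (Polynomial.degree_sum_le _ _).trans_lt ?_
      refine (Finset.sup_lt_iff (WithBot.bot_lt_coe n)).mpr ?_
      intro i hi
      obtain ⟨hi1, hi2⟩ := Finset.mem_Icc.mp hi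
      refine (Polynomial.degree_C_mul_X_pow_le _ _).trans_lt ?_
      exact Nat.cast_lt.mpr (by omega : n - i < n)
    · simp only [Polynomial.eval₂_add, Polynomial.eval₂_finsetSum, Polynomial.eval₂_mul,
        Polynomial.eval₂_pow, Polynomial.eval₂_X, Polynomial.eval₂_C]
      have h1 : ∀ i ∈ Finset.Icc 1 n, algebraMap (reesAlgebra I) (Polynomial R) ⟨_, hm i⟩ *
          Polynomial.monomial 1 x ^ (n - i) = Polynomial.monomial n (a i * x ^ (n - i)) := by
        intro i hi
        obtain ⟨hi1, hi2⟩ := Finset.mem_Icc.mp hi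
        change Polynomial.monomial i (a i) * _ = _
        rw [Polynomial.monomial_pow, Polynomial.monomial_mul_monomial, one_mul,
          Nat.add_sub_cancel' hi2]
      rw [Finset.sum_congr rfl h1, Polynomial.monomial_pow, one_mul, ← map_sum, ← map_add, h,
        map_zero]
  · rintro ⟨p, hp, h⟩
    rcases subsingleton_or_nontrivial R with _ | _
    · exact ⟨1, one_pos, 0, fun i => zero_mem _, Subsingleton.elim _ _⟩
    set N := p.natDegree with hN
    refine ⟨N, ?_, fun i => (p.coeff (N - i)).1.coeff i, fun i => (p.coeff (N - i)).2 i, ?_⟩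
    · by_contra h0
      have h1 : p = 1 := Polynomial.eq_one_of_monic_natDegree_zero hp (by omega)
      rw [h1, Polynomial.eval₂_one] at h
      exact one_ne_zero h
    · have h2 := congrArg (fun q => Polynomial.coeff q N) h
      simp only [Polynomial.eval₂_eq_sum_range, Polynomial.finsetSum_coeff,
        Polynomial.coeff_zero] at h2
      rw [← hN, Finset.sum_range_succ, add_comm] at h2
      rw [← h2]
      have h3 : ∀ j ≤ N, (algebraMap (reesAlgebra I) (Polynomial R) (p.coeff j) *
          Polynomial.monomial 1 x ^ j).coeff N = (p.coeff j).1.coeff (N - j) * x ^ j := by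
        intro j hj
        rw [Polynomial.monomial_pow, one_mul]
        obtain ⟨l, hl⟩ := Nat.exists_eq_add_of_le' hj
        rw [hl, Polynomial.coeff_mul_monomial, Nat.add_sub_cancel]
        rfl
      congr 1
      · rw [h3 N le_rfl, hN, hp.coeff_natDegree, Nat.sub_self]
        simp
      · refine Finset.sum_nbij' (fun i => N - i) (fun j => N - j) ?_ ?_ ?_ ?_ ?_
        · intro i hi
          rw [Finset.mem_Icc] at hi
          rw [Finset.mem_range]
          omega
        · intro i hi
          rw [Finset.mem_range] at hi
          rw [Finset.mem_Icc]
          omega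
        · intro i hi
          rw [Finset.mem_Icc] at hi
          omega
        · intro i hi
          rw [Finset.mem_range] at hi
          omega
        · intro i hi
          rw [Finset.mem_Icc] at hi
          rw [h3 _ (Nat.sub_le N i), Nat.sub_sub_self hi.2]

/-- The integral closure of an ideal. -/
def integralClosureIdeal {R : Type u} [CommRing R] (I : Ideal R) : Ideal R where
  carrier := {x | IsIntegralOverIdeal I x}
  zero_mem' := by
    change IsIntegralOverIdeal I 0
    rw [isIntegralOverIdeal_iff, map_zero]
    exact isIntegral_zero
  add_mem' {x y} hx hy := by
    change IsIntegralOverIdeal I (x + y)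
    rw [Set.mem_ofPred_eq, isIntegralOverIdeal_iff] at hx hy
    rw [isIntegralOverIdeal_iff, map_add]
    exact hx.add hy
  smul_mem' c x hx := by
    change IsIntegralOverIdeal I (c * x)
    rw [Set.mem_ofPred_eq, isIntegralOverIdeal_iff] at hx
    rw [isIntegralOverIdeal_iff]
    have := (isIntegral_algebraMap (R := reesAlgebra I) (A := Polynomial R)
      (x := algebraMap R (reesAlgebra I) c)).mul hx
    rw [← IsScalarTower.algebraMap_apply, Polynomial.algebraMap_apply,
      Polynomial.C_mul_monomial] at this
    exact this

theorem mem_integralClosureIdeal {R : Type u} [CommRing R] {I : Ideal R} {x : R} :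
    x ∈ integralClosureIdeal I ↔ IsIntegralOverIdeal I x := Iff.rfl

/-- Integral closure of ideals commutes with localization. -/
theorem map_integralClosureIdeal {R S : Type u} [CommRing R] [CommRing S] [Algebra R S]
    (M : Submonoid R) [IsLocalization M S] (I : Ideal R) :
    (integralClosureIdeal I).map (algebraMap R S) =
      integralClosureIdeal (I.map (algebraMap R S)) := by
  apply le_antisymm
  · rw [Ideal.map_le_iff_le_comap]
    rintro x ⟨n, hn, a, ha, h⟩
    refine ⟨n, hn, fun i => algebraMap R S (a i), fun i => ?_, ?_⟩
    · rw [← Ideal.map_pow]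
      exact Ideal.mem_map_of_mem _ (ha i)
    · simpa using congrArg (algebraMap R S) h
  · rintro y ⟨n, hn, b, hb, h⟩
    obtain ⟨x, s, rfl⟩ := IsLocalization.exists_mk'_eq M y
    have hb' : ∀ i, ∃ (c : R) (t : R), t ∈ M ∧ c ∈ I ^ i ∧
        b i * algebraMap R S t = algebraMap R S c := by
      intro i
      have h1 := hb i
      rw [← Ideal.map_pow, IsLocalization.mem_map_algebraMap_iff M] at h1
      obtain ⟨⟨c, t⟩, h1⟩ := h1
      exact ⟨c.1, t.1, t.2, c.2, h1⟩
    choose c t ht hc hct using hb'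
    set d : R := ∏ i ∈ Finset.Icc 1 n, t i with hd
    have hdM : d ∈ M := Submonoid.prod_mem _ fun i _ => ht i
    have hdc : ∀ i ∈ Finset.Icc 1 n, ∃ e ∈ I ^ i, b i * algebraMap R S d = algebraMap R S e := by
      intro i hi
      refine ⟨c i * ∏ j ∈ (Finset.Icc 1 n).erase i, t j, Ideal.mul_mem_right _ _ (hc i), ?_⟩
      rw [hd, ← Finset.mul_prod_erase _ _ hi, map_mul, ← mul_assoc, hct, map_mul]
    choose! e he hde using hdc
    have key : algebraMap R S ((d * x) ^ n +
        ∑ i ∈ Finset.Icc 1 n, (e i * d ^ (i - 1) * s.1 ^ i) * (d * x) ^ (n - i)) =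
        algebraMap R S 0 := by
      have h2 := congrArg (fun z => algebraMap R S (d * s.1) ^ n * z) h
      simp only [mul_add, Finset.mul_sum, mul_zero] at h2
      rw [map_zero, ← h2, map_add, map_sum]
      have hx : algebraMap R S x = algebraMap R S s.1 * IsLocalization.mk' S x s :=
        (IsLocalization.mk'_spec' S x s).symm
      congr 1
      · simp only [map_mul, map_pow, hx]; ring
      · refine Finset.sum_congr rfl fun i hi => ?_
        have h3 := hde i hi
        obtain ⟨hi1, hi2⟩ := Finset.mem_Icc.mp hi
        obtain ⟨j, rfl⟩ := Nat.exists_eq_add_of_le hi1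
        obtain ⟨l, rfl⟩ := Nat.exists_eq_add_of_le hi2
        simp only [map_mul, map_pow, hx, ← h3, Nat.add_sub_cancel_left]
        ring
    obtain ⟨w, hw⟩ := (IsLocalization.eq_iff_exists M S).mp key
    rw [mul_zero] at hw
    have hmem : w.1 * (d * x) ∈ integralClosureIdeal I := by
      refine ⟨n, hn, fun i => if i ∈ Finset.Icc 1 n then
        w.1 ^ i * (e i * d ^ (i - 1) * s.1 ^ i) else 0, fun i => ?_, ?_⟩
      · dsimp only
        split_ifs with hi
        · exact Ideal.mul_mem_left _ _ (Ideal.mul_mem_right _ _ (Ideal.mul_mem_right _ _ (he i hi)))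
        · exact zero_mem _
      · obtain ⟨n, rfl⟩ := Nat.exists_eq_succ_of_ne_zero hn.ne'
        have h4 := congrArg (fun z => w.1 ^ n * z) hw
        simp only [mul_add, Finset.mul_sum, mul_zero] at h4
        refine Eq.trans ?_ h4
        congr 1
        · rw [mul_pow, pow_succ w.1 n]
          ring
        · refine Finset.sum_congr rfl fun i hi => ?_
          dsimp only
          rw [if_pos hi]
          obtain ⟨hi1, hi2⟩ := Finset.mem_Icc.mp hi
          obtain ⟨l, hl⟩ := Nat.exists_eq_add_of_le hi2
          have h5 : n.succ - i = l := by omega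
          rw [h5, mul_pow w.1 (d * x) l]
          have h6 : w.1 ^ i * w.1 ^ l = w.1 ^ n * w.1 := by
            rw [← pow_add, ← hl, pow_succ]
          linear_combination (e i * d ^ (i - 1) * s.1 ^ i * (d * x) ^ l) * h6
    rw [IsLocalization.mem_map_algebraMap_iff M]
    refine ⟨(⟨_, hmem⟩, w * ⟨d, hdM⟩ * s), ?_⟩
    have hx : algebraMap R S x = IsLocalization.mk' S x s * algebraMap R S s.1 :=
      (IsLocalization.mk'_spec S x s).symm
    simp only [Submonoid.coe_mul, map_mul, hx]
    ring

end IntegralClosure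

section Schemes

/-- The integral closure of an ideal sheaf: its sections on an affine open `U` are the elements
of `Γ(X, U)` that are integral over `I(U)`. -/
noncomputable def integralClosure {X : Scheme.{u}} (I : X.IdealSheafData) : X.IdealSheafData where
  ideal U := integralClosureIdeal (I.ideal U)
  map_ideal_basicOpen U f := by
    let : Algebra Γ(X, U) Γ(X, X.affineBasicOpen f) :=
      (X.presheaf.map (homOfLE (X.basicOpen_le f)).op).hom.toAlgebra
    have : IsLocalization.Away f Γ(X, X.basicOpen f) := U.2.isLocalization_of_eq_basicOpen _ _ rfl
    exact (map_integralClosureIdeal (S := Γ(X, X.basicOpen f)) (.powers f) (I.ideal U)).trans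
      congr(integralClosureIdeal $(I.map_ideal_basicOpen U f))

/-- The stalk at `x` of an ideal sheaf, as an ideal of the local ring at `x`. -/
noncomputable def stalkIdeal {X : Scheme.{u}} (I : X.IdealSheafData) (x : X) : Ideal (X.presheaf.stalk x) :=
  ⨆ (U : X.affineOpens) (hx : x ∈ U.1), (I.ideal U).map (X.presheaf.germ U.1 x hx).hom

/-- A scheme is non-singular if all its local rings are regular. -/
def IsNonsingular (X : Scheme.{u}) : Prop :=
  ∀ x : X, IsRegularLocalRing (X.presheaf.stalk x)

/-- `t` is a regular system of parameters of the local ring `R`. -/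
def IsRegularSystemOfParameters {R : Type u} [CommRing R] [IsLocalRing R] {n : ℕ}
    (t : Fin n → R) : Prop :=
  Ideal.span (Set.range t) = IsLocalRing.maximalIdeal R ∧ ringKrullDim R = n

/-- The closed subsets `H₁, …, H_r` are the components of a simple normal crossings divisor: each
`H i` is irreducible and, at every point `y`, there is a regular system of parameters `t` of the
local ring such that the (reduced) ideals of those `H i` that pass through `y` are generated there
by distinct members of `t`. -/
structure IsSimpleNormalCrossings {Y : Scheme.{u}} {r : ℕ} (H : Fin r → Closeds Y) : Prop where
  isIrreducible : ∀ i, IsIrreducible (H i : Set Y)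
  normalCrossings : ∀ y : Y, ∃ (n : ℕ) (t : Fin n → Y.presheaf.stalk y)
    (c : {i : Fin r // y ∈ H i} → Fin n),
    IsRegularSystemOfParameters t ∧ Function.Injective c ∧
      ∀ i, stalkIdeal (Scheme.IdealSheafData.vanishingIdeal (H i.1)) y = Ideal.span {t (c i)}

/-- The complement `W \ Supp(I)` of the support of an ideal sheaf (the support of `𝒪_W / I`). -/
def supportCompl {W : Scheme.{u}} (I : W.IdealSheafData) : W.Opens := I.support.compl

/-- `π : W' ⟶ W` is a log-resolution of the ideal sheaf `I` with exceptional hypersurfaces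
`H₁, …, H_r` and exponents `a₁, …, a_r`. -/
structure IsLogResolution {W' W : Scheme.{u}} (π : W' ⟶ W) (I : W.IdealSheafData) {r : ℕ}
    (H : Fin r → Closeds W') (a : Fin r → ℕ) : Prop where
  isProper : IsProper π
  /-- `π` restricts to an isomorphism between dense opens of `W'` and of `W`. -/
  birational : Scheme.BirationalOver π (𝟙 W)
  isNonsingular : IsNonsingular W'
  isIso_restrict : IsIso (π ∣_ supportCompl I)
  compl_eq : ((π ⁻¹ᵁ supportCompl I : W'.Opens) : Set W')ᶜ = ⋃ i, (H i : Set W')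
  isSimpleNormalCrossings : IsSimpleNormalCrossings H
  /-- `I 𝒪_{W'} = I(H₁)^{a₁} ⋯ I(H_r)^{a_r}`. -/
  totalTransform : I.comap π = ∏ i, Scheme.IdealSheafData.vanishingIdeal (H i) ^ a i

/-- The contraction `J ∩ 𝒪_W` along `π : W' ⟶ W` of an ideal sheaf `J` of `𝒪_{W'}`. For
quasi-compact `π`, its sections on an affine open are the functions whose pullback along `π` lies
in `J`; see `mem_contraction_iff`. -/
noncomputable def contraction {W' W : Scheme.{u}} (J : W'.IdealSheafData) (π : W' ⟶ W) :
    W.IdealSheafData := J.map π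

theorem mem_contraction_iff {W' W : Scheme.{u}} (J : W'.IdealSheafData) (π : W' ⟶ W)
    [QuasiCompact π] (V : W.affineOpens) (f : Γ(W, V)) :
    f ∈ (contraction J π).ideal V ↔
      ∀ (U : W'.affineOpens) (h : U.1 ≤ π ⁻¹ᵁ V.1), (π.appLE V.1 U.1 h).hom f ∈ J.ideal U := by
  have hmem : ∀ (U : W'.affineOpens) (h : U.1 ≤ π ⁻¹ᵁ V.1),
      (π.appLE V.1 U.1 h).hom f ∈ J.ideal U ↔
      (J.subscheme.presheaf.map (homOfLE (J.subschemeι.preimage_mono h)).op).hom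
        (((J.subschemeι ≫ π).app V.1).hom f) = 0 := by
    intro U h
    rw [← J.ker_subschemeι_app U, RingHom.mem_ker]
    simp only [← RingHom.comp_apply, ← CommRingCat.hom_comp]
    congr! 3
    simp [Scheme.Hom.appLE]
    rfl
  simp only [hmem]
  rw [contraction, Scheme.IdealSheafData.map, Scheme.Hom.ker_apply, RingHom.mem_ker]
  constructor
  · intro h U hU
    rw [h]
    exact map_zero _
  · intro h
    apply J.subscheme.IsSheaf.section_ext
    intro x hx
    obtain ⟨_, ⟨U, hU, rfl⟩, hxU, hUV⟩ := W'.isBasis_affineOpens.exists_subset_of_mem_open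
      (show J.subschemeι x ∈ (π ⁻¹ᵁ V.1 : W'.Opens) from hx) (π ⁻¹ᵁ V.1).2
    refine ⟨J.subschemeι ⁻¹ᵁ U, J.subschemeι.preimage_mono hUV, hxU, ?_⟩
    exact (h ⟨U, hU⟩ hUV).trans (map_zero _).symm

end Schemes

end LogRes

/-! Inverse image commutes with powers, so $\mathcal I^m\mathcal O_{W'}$ is the product of the
$\mathbf I(H_i)^{ma_i}$, and two inclusions remain. For "$\subseteq$", an integral equation pulls
back to each local ring of $W'$. By normal crossings, the total transform there is a product of
powers of principal ideals, each generated by a regular parameter or equal to the unit ideal.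
Regular parameters are prime elements of a domain, so such a product is integrally closed
(`IsIntegralOverIdeal.mem_prod`, `integralClosure_le_contraction_prod`). For "$\supseteq$", the
valuative criterion for integrality (`isIntegralOverIdeal_of_forall_valuationSubring`) is applied at
each local ring of $W$, a domain with fraction field $K$. Birationality lifts $\operatorname{Spec}K$
to $W'$, and properness extends the lift to any valuation ring $O$ of $K$ containing the local ring.
A section whose pullback lies in $\mathcal I^m\mathcal O_{W'}$ therefore lands in $\mathcal I^mO$
(`contraction_comap_le_integralClosure`). -/

namespace LogRes

/-! ### Regular local rings are domains, and regular parameters are prime. -/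

section Regular

open IsLocalRing

/-- A minimal prime $q\subseteq(x)$ does not contain $x$, hence $q=xq$, and Nakayama gives $q=0$. -/
theorem isDomain_of_isPrime_span_singleton {R : Type u} [CommRing R] [IsLocalRing R]
    [IsNoetherianRing R] {x : R} (hx : (Ideal.span {x}).IsPrime)
    (hmin : ∀ q ∈ minimalPrimes R, x ∉ q) : IsDomain R := by
  obtain ⟨q, hq, hqx⟩ := Ideal.exists_minimalPrimes_le (I := (⊥ : Ideal R)) (J := Ideal.span {x})
    bot_le
  have hqp : q.IsPrime := hq.1.1
  have h1 : q ≤ Ideal.span {x} • q := by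
    intro y hy
    obtain ⟨z, rfl⟩ := Ideal.mem_span_singleton.mp (hqx hy)
    have hz : z ∈ q := (hqp.mem_or_mem hy).resolve_left (hmin q hq)
    exact Submodule.smul_mem_smul (Ideal.mem_span_singleton_self x) hz
  have h2 : q = ⊥ := Submodule.eq_bot_of_le_smul_of_le_jacobson_bot _ q
    (IsNoetherian.noetherian q) h1 ((le_maximalIdeal hx.ne_top).trans
      (maximalIdeal_le_jacobson _))
  rw [h2] at hqp
  exact IsDomain.of_bot_isPrime R

theorem maximalIdeal_quotient_eq_map {R : Type u} [CommRing R] [IsLocalRing R] (I : Ideal R)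
    [IsLocalRing (R ⧸ I)] :
    maximalIdeal (R ⧸ I) = (maximalIdeal R).map (Ideal.Quotient.mk I) := by
  refine le_antisymm ?_ ?_
  · intro y hy
    obtain ⟨x, rfl⟩ := Ideal.Quotient.mk_surjective y
    refine Ideal.mem_map_of_mem _ ?_
    rw [mem_maximalIdeal, mem_nonunits_iff] at hy ⊢
    exact fun h => hy (h.map _)
  · exact ((local_hom_TFAE (Ideal.Quotient.mk I)).out 0 2).mp
      (IsLocalHom.of_surjective _ Ideal.Quotient.mk_surjective)

theorem span_range_comp_succAbove {R : Type u} [CommRing R] {n : ℕ} (t : Fin (n + 1) → R)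
    (i : Fin (n + 1)) :
    Ideal.span (Set.range (Ideal.Quotient.mk (Ideal.span {t i}) ∘ t ∘ i.succAbove)) =
      (Ideal.span (Set.range t)).map (Ideal.Quotient.mk (Ideal.span {t i})) := by
  rw [Ideal.map_span, ← Set.range_comp]
  refine le_antisymm (Ideal.span_mono ?_) (Ideal.span_le.mpr ?_)
  · rintro _ ⟨j, rfl⟩
    exact ⟨i.succAbove j, rfl⟩
  · rintro _ ⟨j, rfl⟩
    rcases Fin.eq_self_or_eq_succAbove i j with rfl | ⟨j, rfl⟩
    · simp only [Function.comp_apply, SetLike.mem_coe]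
      rw [Ideal.Quotient.eq_zero_iff_mem.mpr (Ideal.mem_span_singleton_self _)]
      exact zero_mem _
    · exact Ideal.subset_span ⟨j, rfl⟩

theorem le_ringKrullDim_quotient_span_singleton {R : Type u} [CommRing R] [IsLocalRing R]
    [IsNoetherianRing R] {n : ℕ} (hn : (n + 1 : ℕ) ≤ ringKrullDim R) {x : R}
    (hx : x ∈ maximalIdeal R) : (n : WithBot ℕ∞) ≤ ringKrullDim (R ⧸ Ideal.span {x}) := by
  have h := ringKrullDim_le_ringKrullDim_quotient_add_card ({x} : Finset R) (by
    rw [Finset.coe_singleton, Set.singleton_subset_iff]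
    rwa [SetLike.mem_coe, ringJacobson_eq_maximalIdeal])
  rw [Finset.coe_singleton, Finset.card_singleton] at h
  have h2 := hn.trans h
  rw [Nat.cast_add] at h2
  exact (WithBot.add_le_add_iff_right' (WithBot.natCast_ne_bot 1)
    (WithBot.coe_inj.not.mpr (ENat.natCast_ne_top 1))).mp h2

/-- Exchange: if every coefficient in $x=\sum c_it_i$ lay in the maximal ideal, $x$ would lie in its
square. So some $c_i$ is a unit and $x$ can replace $t_i$. -/
theorem exists_span_range_update_eq_maximalIdeal {R : Type u} [CommRing R] [IsLocalRing R]
    {n : ℕ} {t : Fin n → R} (ht : Ideal.span (Set.range t) = maximalIdeal R) {x : R}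
    (hx : x ∈ maximalIdeal R) (hx2 : x ∉ maximalIdeal R ^ 2) :
    ∃ i, Ideal.span (Set.range (Function.update t i x)) = maximalIdeal R := by
  rw [← ht, Ideal.mem_span_range_iff_exists_fun] at hx
  obtain ⟨c, rfl⟩ := hx
  obtain ⟨i, hi⟩ : ∃ i, c i ∉ maximalIdeal R := by
    by_contra! h
    refine hx2 (sum_mem fun i _ => ?_)
    rw [pow_two]
    exact Ideal.mul_mem_mul (h i) (ht ▸ Ideal.subset_span ⟨i, rfl⟩)
  rw [mem_maximalIdeal, mem_nonunits_iff, not_not] at hi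
  refine ⟨i, le_antisymm (Ideal.span_le.mpr ?_) (ht ▸ Ideal.span_le.mpr ?_)⟩
  · rintro _ ⟨j, rfl⟩
    have hmem : ∀ j, t j ∈ maximalIdeal R := fun j => ht ▸ Ideal.subset_span ⟨j, rfl⟩
    rcases eq_or_ne j i with rfl | hj
    · rw [Function.update_self]
      exact sum_mem fun i _ => Ideal.mul_mem_left _ _ (hmem i)
    · rw [Function.update_of_ne hj]
      exact hmem j
  · set J := Ideal.span (Set.range (Function.update t i (∑ i, c i * t i))) with hJ
    have hne : ∀ j, j ≠ i → t j ∈ J := fun j hj =>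
      Ideal.subset_span ⟨j, Function.update_of_ne hj _ _⟩
    have hsum : ∑ i, c i * t i ∈ J := Ideal.subset_span ⟨i, Function.update_self _ _ _⟩
    rintro _ ⟨j, rfl⟩
    rcases eq_or_ne j i with rfl | hj
    · rw [← Finset.add_sum_erase _ _ (Finset.mem_univ j)] at hsum
      have h := (Submodule.add_mem_iff_left J (sum_mem fun k hk =>
        Ideal.mul_mem_left _ _ (hne k (Finset.ne_of_mem_erase hk)))).mp hsum
      exact (J.unit_mul_mem_iff_mem hi).mp h
    · exact hne j hj

/-- A Noetherian local ring whose maximal ideal is generated by `dim R` elements is a domain. -/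
theorem isDomain_of_span_range_eq_maximalIdeal (n : ℕ) : ∀ {R : Type u} [CommRing R]
    [IsLocalRing R] [IsNoetherianRing R] (t : Fin n → R),
    Ideal.span (Set.range t) = maximalIdeal R → n ≤ ringKrullDim R → IsDomain R := by
  induction n with
  | zero =>
    intro R _ _ _ t ht _
    have h : maximalIdeal R = ⊥ := by
      rw [← ht, Set.range_eq_empty, Ideal.span_empty]
    exact ((isField_iff_maximalIdeal_eq).mpr h).isDomain
  | succ n ih =>
    intro R _ _ _ t ht hn
    -- The quotient by one generator has $n$ generators and dimension at least $n$, so the induction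
    -- hypothesis applies.
    have hquot : ∀ s : Fin (n + 1) → R, Ideal.span (Set.range s) = maximalIdeal R →
        ∀ i, (Ideal.span {s i}).IsPrime := by
      intro s hs i
      have hi : s i ∈ maximalIdeal R := hs ▸ Ideal.subset_span ⟨i, rfl⟩
      have hne : Ideal.span {s i} ≠ ⊤ := ne_top_of_le_ne_top (maximalIdeal.isMaximal R).ne_top
        (by rwa [Ideal.span_singleton_le_iff_mem])
      have : Nontrivial (R ⧸ Ideal.span {s i}) := Ideal.Quotient.nontrivial_iff.mpr hne
      have : IsLocalRing (R ⧸ Ideal.span {s i}) :=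
        .of_surjective' (Ideal.Quotient.mk _) Ideal.Quotient.mk_surjective
      rw [← Ideal.Quotient.isDomain_iff_prime]
      exact ih _ ((span_range_comp_succAbove s i).trans
        (by rw [hs, maximalIdeal_quotient_eq_map])) (le_ringKrullDim_quotient_span_singleton hn hi)
    have hheight : ∀ q ∈ minimalPrimes R, ¬ maximalIdeal R ≤ q := by
      intro q hq hle
      have hqp : q.IsPrime := hq.1.1
      have hqm : q = maximalIdeal R := le_antisymm (le_maximalIdeal hqp.ne_top) hle
      have h0 : (maximalIdeal R).height = 0 := by
        rw [Ideal.height_eq_zero_iff, ← hqm]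
        exact hq
      rw [← maximalIdeal_height_eq_ringKrullDim, h0] at hn
      have : ((n + 1 : ℕ) : WithBot ℕ∞) ≤ ((0 : ℕ) : WithBot ℕ∞) := hn
      simp only [Nat.cast_le] at this
      omega
    obtain ⟨x, hx, hx2, hxq⟩ : ∃ x ∈ maximalIdeal R, x ∉ maximalIdeal R ^ 2 ∧
        ∀ q ∈ minimalPrimes R, x ∉ q := by
      by_contra! h
      have hsub : (maximalIdeal R : Set R) ⊆
          ⋃ I ∈ insert (maximalIdeal R ^ 2) (minimalPrimes R), (I : Set R) := by
        intro x hx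
        simp only [Set.mem_insert_iff, Set.iUnion_iUnion_eq_or_left, Set.mem_union,
          SetLike.mem_coe, Set.mem_iUnion, exists_prop]
        by_cases h2 : x ∈ maximalIdeal R ^ 2
        · exact Or.inl h2
        · exact Or.inr (h x hx h2)
      -- Prime avoidance tolerates the non-prime ideal $\mathfrak m^2$. If $\mathfrak
      -- m\subseteq\mathfrak m^2$, Nakayama gives $\mathfrak m=0$; both cases then contradict the
      -- positive dimension.
      obtain ⟨I, hI, hle⟩ := (Ideal.subset_union_prime_finite
        ((minimalPrimes.finite_of_isNoetherianRing R).insert _) (f := fun I => I)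
        (maximalIdeal R ^ 2) (maximalIdeal R ^ 2) (fun I hI h1 _ =>
          ((Set.mem_insert_iff.mp hI).resolve_left h1).1.1)).mp hsub
      rcases Set.mem_insert_iff.mp hI with rfl | hI
      · have hbot : maximalIdeal R = ⊥ := by
          refine Submodule.eq_bot_of_le_smul_of_le_jacobson_bot (maximalIdeal R) _
            (IsNoetherian.noetherian _) ?_ (maximalIdeal_le_jacobson _)
          rwa [smul_eq_mul, ← pow_two]
        obtain ⟨q, hq⟩ := Ideal.nonempty_minimalPrimes (I := (⊥ : Ideal R)) bot_ne_top
        exact hheight q hq (hbot ▸ bot_le)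
      · exact hheight I hI hle
    obtain ⟨i, hi⟩ := exists_span_range_update_eq_maximalIdeal ht hx hx2
    have hp := hquot _ hi i
    rw [Function.update_self] at hp
    exact isDomain_of_isPrime_span_singleton hp hxq

theorem IsRegularSystemOfParameters.isDomain {R : Type u} [CommRing R] [IsLocalRing R]
    [IsNoetherianRing R] {n : ℕ} {t : Fin n → R} (ht : IsRegularSystemOfParameters t) :
    IsDomain R :=
  isDomain_of_span_range_eq_maximalIdeal n t ht.1 ht.2.ge

theorem IsRegularSystemOfParameters.isPrime_span_singleton {R : Type u} [CommRing R]
    [IsLocalRing R] [IsNoetherianRing R] {n : ℕ} {t : Fin n → R}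
    (ht : IsRegularSystemOfParameters t) (i : Fin n) : (Ideal.span {t i}).IsPrime := by
  obtain _ | n := n
  · exact i.elim0
  have hi : t i ∈ maximalIdeal R := ht.1 ▸ Ideal.subset_span ⟨i, rfl⟩
  have hne : Ideal.span {t i} ≠ ⊤ := ne_top_of_le_ne_top (maximalIdeal.isMaximal R).ne_top
    (by rwa [Ideal.span_singleton_le_iff_mem])
  have : Nontrivial (R ⧸ Ideal.span {t i}) := Ideal.Quotient.nontrivial_iff.mpr hne
  have : IsLocalRing (R ⧸ Ideal.span {t i}) :=
    .of_surjective' (Ideal.Quotient.mk _) Ideal.Quotient.mk_surjective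
  rw [← Ideal.Quotient.isDomain_iff_prime]
  exact isDomain_of_span_range_eq_maximalIdeal n _ ((span_range_comp_succAbove t i).trans
    (by rw [ht.1, maximalIdeal_quotient_eq_map]))
    (le_ringKrullDim_quotient_span_singleton ht.2.ge hi)

/-- A zero parameter could be dropped, leaving fewer generators of the maximal ideal than the
dimension. -/
theorem IsRegularSystemOfParameters.ne_zero {R : Type u} [CommRing R]
    [IsLocalRing R] {n : ℕ} {t : Fin n → R} (ht : IsRegularSystemOfParameters t)
    [IsNoetherianRing R] (i : Fin n) : t i ≠ 0 := by
  obtain _ | n := n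
  · exact i.elim0
  intro h
  have hspan : Submodule.span R (Set.range (t ∘ i.succAbove)) = maximalIdeal R := by
    refine le_antisymm (Submodule.span_le.mpr ?_) (ht.1 ▸ Ideal.span_le.mpr ?_)
    · rintro _ ⟨j, rfl⟩
      exact ht.1 ▸ Ideal.subset_span ⟨_, rfl⟩
    · rintro _ ⟨j, rfl⟩
      rcases Fin.eq_self_or_eq_succAbove i j with rfl | ⟨j, rfl⟩
      · rw [h]
        exact zero_mem _
      · exact Submodule.subset_span ⟨j, rfl⟩
  have h1 : (maximalIdeal R).spanFinrank ≤ n := by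
    rw [← hspan]
    refine (Submodule.spanFinrank_span_le_ncard_of_finite (Set.finite_range _)).trans ?_
    rw [← Nat.card_coe_set_eq]
    exact (Finite.card_range_le _).trans (Nat.card_fin n).le
  have h2 := ht.2.ge.trans ((ringKrullDim_le_spanFinrank_maximalIdeal R).trans
    (Nat.cast_le.mpr h1))
  rw [Nat.cast_le] at h2
  omega

theorem IsRegularSystemOfParameters.prime {R : Type u} [CommRing R]
    [IsLocalRing R] [IsNoetherianRing R] {n : ℕ} {t : Fin n → R}
    (ht : IsRegularSystemOfParameters t) (i : Fin n) : Prime (t i) :=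
  (Ideal.span_singleton_prime (ht.ne_zero i)).mp (ht.isPrime_span_singleton i)

theorem isDomain_of_isRegularLocalRing (R : Type u) [CommRing R] [IsRegularLocalRing R] :
    IsDomain R := by
  obtain ⟨s, hs, hspan⟩ := Submodule.FG.exists_span_finset_card_eq_spanFinrank
    (IsNoetherian.noetherian (maximalIdeal R))
  refine isDomain_of_span_range_eq_maximalIdeal s.card (fun i => (s.equivFin.symm i : R)) ?_ ?_
  · rw [← hspan]
    congr 1
    ext x
    constructor
    · rintro ⟨i, rfl⟩
      exact (s.equivFin.symm i).2
    · intro hx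
      exact ⟨s.equivFin ⟨x, hx⟩, by simp⟩
  · rw [hs, IsRegularLocalRing.spanFinrank_maximalIdeal]

end Regular

/-! ### Integrality over ideals of a domain. -/

section Integral

/-- The $i$-th coefficient is divisible by $p^i$, so $p\mid x^n$ and hence $p\mid x$. Cancelling
$p^n$ leaves an equation for $x/p$ over $J$. -/
theorem IsIntegralOverIdeal.exists_eq_mul {R : Type u} [CommRing R] [IsDomain R] {p x : R}
    (hp : Prime p) {J : Ideal R} (h : IsIntegralOverIdeal (Ideal.span {p} * J) x) :
    ∃ y, x = p * y ∧ IsIntegralOverIdeal J y := by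
  obtain ⟨n, hn, a, ha, h⟩ := h
  have ha' : ∀ i, ∃ c ∈ J ^ i, a i = p ^ i * c := by
    intro i
    have hi := ha i
    rw [mul_pow, Ideal.span_singleton_pow, Ideal.mem_span_singleton_mul] at hi
    obtain ⟨c, hc, h⟩ := hi
    exact ⟨c, hc, h.symm⟩
  choose c hc hac using ha'
  have hdvd : p ∣ x ^ n := by
    rw [eq_neg_of_add_eq_zero_left h, dvd_neg]
    refine Finset.dvd_sum fun i hi => Dvd.dvd.mul_right ?_ _
    rw [hac]
    exact (dvd_pow_self p (by have := (Finset.mem_Icc.mp hi).1; omega)).mul_right _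
  obtain ⟨y, rfl⟩ := hp.dvd_of_dvd_pow hdvd
  refine ⟨y, rfl, n, hn, c, hc, mul_left_cancel₀ (pow_ne_zero n hp.ne_zero) ?_⟩
  rw [mul_zero, ← h, mul_add, mul_pow, Finset.mul_sum]
  congr 1
  refine Finset.sum_congr rfl fun i hi => ?_
  obtain ⟨l, rfl⟩ := Nat.exists_eq_add_of_le (Finset.mem_Icc.mp hi).2
  rw [hac, Nat.add_sub_cancel_left, mul_pow, pow_add]
  ring

theorem IsIntegralOverIdeal.exists_eq_pow_mul {R : Type u} [CommRing R] [IsDomain R] {p : R}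
    (hp : Prime p) {J : Ideal R} (b : ℕ) : ∀ {x : R},
    IsIntegralOverIdeal (Ideal.span {p} ^ b * J) x →
      ∃ y, x = p ^ b * y ∧ IsIntegralOverIdeal J y := by
  induction b with
  | zero => exact fun h => ⟨_, (by rw [pow_zero, one_mul]), by simpa using h⟩
  | succ b ih =>
    intro x h
    rw [pow_succ', mul_assoc] at h
    obtain ⟨y, rfl, hy⟩ := h.exists_eq_mul hp
    obtain ⟨z, rfl, hz⟩ := ih hy
    exact ⟨z, by ring, hz⟩

/-- A product of powers of principal prime ideals of a domain is integrally closed. -/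
theorem IsIntegralOverIdeal.mem_prod {R : Type u} [CommRing R] [IsDomain R] {ι : Type*}
    (s : Finset ι) (L : ι → Ideal R) (b : ι → ℕ)
    (hL : ∀ i, L i = ⊤ ∨ ∃ p, Prime p ∧ L i = Ideal.span {p}) : ∀ {x : R},
    IsIntegralOverIdeal (∏ i ∈ s, L i ^ b i) x → x ∈ ∏ i ∈ s, L i ^ b i := by
  classical
  induction s using Finset.induction_on with
  | empty => simp
  | insert i s hi ih =>
    intro x hx
    rw [Finset.prod_insert hi] at hx ⊢
    rcases hL i with h | ⟨p, hp, h⟩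
    · rw [h, Ideal.top_pow, Ideal.top_mul] at hx ⊢
      exact ih hx
    · rw [h] at hx ⊢
      obtain ⟨y, rfl, hy⟩ := hx.exists_eq_pow_mul hp
      exact Ideal.mul_mem_mul (Ideal.pow_mem_pow (Ideal.mem_span_singleton_self p) _) (ih hy)

theorem IsIntegralOverIdeal.map {R S : Type u} [CommRing R] [CommRing S] (φ : R →+* S)
    {I : Ideal R} {J : Ideal S} (hIJ : I.map φ ≤ J) {x : R} (h : IsIntegralOverIdeal I x) :
    IsIntegralOverIdeal J (φ x) := by
  obtain ⟨n, hn, a, ha, h⟩ := h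
  refine ⟨n, hn, fun i => φ (a i), fun i => ?_, by simpa using congrArg φ h⟩
  exact Ideal.pow_right_mono hIJ i (Ideal.map_pow φ I i ▸ Ideal.mem_map_of_mem φ (ha i))

/-- The valuative criterion for integrality over an ideal of a domain. -/
theorem isIntegralOverIdeal_of_forall_valuationSubring {S K : Type u} [CommRing S] [IsDomain S]
    [Field K] [Algebra S K] [IsFractionRing S K] (J : Ideal S) (f : S)
    (H : ∀ (V : ValuationSubring K) (ρ : S →+* V), V.subtype.comp ρ = algebraMap S K →
      ρ f ∈ J.map ρ) : IsIntegralOverIdeal J f := by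
  rcases eq_or_ne f 0 with rfl | hf
  · exact (integralClosureIdeal J).zero_mem
  have hf' : algebraMap S K f ≠ 0 := by
    rwa [Ne, FaithfulSMul.algebraMap_eq_zero_iff]
  -- Setting $T=1/f$ maps the Rees algebra onto $S[J/f]\subseteq K$; `Q` is its part of positive
  -- degree.
  let φ : reesAlgebra J →+* K :=
    ((Polynomial.aeval (algebraMap S K f)⁻¹ : Polynomial S →ₐ[S] K) : Polynomial S →+* K).comp
      (reesAlgebra J).val.toRingHom
  have hφ : ∀ p : reesAlgebra J, φ p = Polynomial.aeval (algebraMap S K f)⁻¹ p.1 := fun _ => rfl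
  let Q : Ideal (reesAlgebra J) :=
    RingHom.ker (Polynomial.constantCoeff.comp (reesAlgebra J).val.toRingHom)
  -- If `Q` generates the unit ideal, then $1=\sum_{i\ge1}a_if^{-i}$ with $a_i\in J^i$, and
  -- multiplying by $f^n$ gives the integral equation. Taking $n$ one above the degree ensures
  -- $n>0$.
  by_cases hQ : Q.map φ.rangeRestrict = ⊤
  · obtain ⟨p, hpQ, hp⟩ := (Ideal.mem_map_iff_of_surjective _ φ.rangeRestrict_surjective).mp
      (hQ ▸ Submodule.mem_top : (1 : φ.range) ∈ Q.map φ.rangeRestrict)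
    have hp0 : p.1.coeff 0 = 0 := hpQ
    have hp1 : Polynomial.aeval (algebraMap S K f)⁻¹ p.1 = 1 := congrArg Subtype.val hp
    set n := p.1.natDegree + 1 with hn
    refine ⟨n, Nat.succ_pos _, fun i => -p.1.coeff i, fun i => neg_mem (p.2 i), ?_⟩
    rw [Polynomial.aeval_eq_sum_range' (n := n + 1) (by omega), Finset.sum_range_succ', hp0,
      zero_smul, add_zero] at hp1
    apply FaithfulSMul.algebraMap_injective S K
    rw [map_add, map_sum, map_zero, map_pow, ← mul_one (algebraMap S K f ^ n), ← hp1,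
      Finset.mul_sum, Finset.sum_nbij' (t := Finset.Icc 1 n)
        (g := fun i => algebraMap S K (p.1.coeff i * f ^ (n - i))) (· + 1) (· - 1)]
    · rw [← Finset.sum_add_distrib]
      exact Finset.sum_eq_zero fun i _ => by rw [← map_add]; simp
    · intro i hi
      rw [Finset.mem_range] at hi
      rw [Finset.mem_Icc]
      omega
    · intro i hi
      rw [Finset.mem_Icc] at hi
      rw [Finset.mem_range]
      omega
    · intro i _
      exact Nat.add_sub_cancel _ _
    · intro i hi
      exact Nat.sub_add_cancel (Finset.mem_Icc.mp hi).1
    · intro i hi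
      obtain ⟨l, hl⟩ := Nat.exists_eq_add_of_le (Nat.succ_le_of_lt (Finset.mem_range.mp hi))
      rw [hl, Nat.succ_eq_add_one, Nat.add_sub_cancel_left, Algebra.smul_def, map_mul, map_pow,
        pow_add, inv_pow]
      field_simp
  -- Otherwise some valuation ring $V\supseteq S[J/f]$ has $J/f$ in its maximal ideal. Then $f\in
  -- JV\subseteq f\mathfrak m_V$, which is absurd since $f\ne0$.
  · obtain ⟨V, hAV, hV⟩ := Ideal.image_subset_nonunits_valuationSubring _ hQ
    have hS : ∀ s, algebraMap S K s ∈ V.toSubring := by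
      intro s
      refine hAV ⟨algebraMap S (reesAlgebra J) s, ?_⟩
      rw [hφ]
      exact Polynomial.aeval_C _ s
    let ρ : S →+* V := (algebraMap S K).codRestrict V.toSubring hS
    have h1 := H V ρ rfl
    have h2 : J.map ρ ≤ Ideal.span {ρ f} * IsLocalRing.maximalIdeal V := by
      rw [Ideal.map_le_iff_le_comap]
      intro j hj
      rw [Ideal.mem_comap, Ideal.mem_span_singleton_mul]
      have hmem : φ ⟨Polynomial.monomial 1 j, reesAlgebra.monomial_mem.mpr (by simpa using hj)⟩ ∈
          V.nonunits := by
        refine hV ⟨_, Ideal.mem_map_of_mem _ (show _ ∈ Q from ?_), rfl⟩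
        rw [RingHom.mem_ker]
        exact Polynomial.coeff_monomial_of_ne _ (by simp)
      rw [hφ, Polynomial.aeval_monomial, pow_one] at hmem
      obtain ⟨hm, hm'⟩ := V.mem_nonunits_iff_exists_mem_maximalIdeal.mp hmem
      refine ⟨_, hm', Subtype.ext ?_⟩
      change algebraMap S K f * (algebraMap S K j * (algebraMap S K f)⁻¹) = algebraMap S K j
      field_simp
    obtain ⟨z, hz, hz1⟩ := Ideal.mem_span_singleton_mul.mp (h2 h1)
    have hρ : ρ f ≠ 0 := fun h => hf' (congrArg Subtype.val h)
    have : z = 1 := mul_left_cancel₀ hρ (hz1.trans (mul_one _).symm)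
    exact absurd (this ▸ hz) ((Ideal.ne_top_iff_one _).mp (IsLocalRing.maximalIdeal.isMaximal V).ne_top)

end Integral

/-! ### Stalks and inverse images of ideal sheaves on affine charts. -/

section IdealSheaves

theorem map_germ_ideal_eq {X : Scheme.{u}} (J : X.IdealSheafData) {x : X} (U V : X.affineOpens)
    (hU : x ∈ U.1) (hV : x ∈ V.1) :
    (J.ideal U).map (X.presheaf.germ U.1 x hU).hom =
      (J.ideal V).map (X.presheaf.germ V.1 x hV).hom := by
  have key : ∀ (U N : X.affineOpens) (hN : x ∈ N.1) (h : N.1 ≤ U.1),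
      (J.ideal U).map (X.presheaf.germ U.1 x (h hN)).hom =
        (J.ideal N).map (X.presheaf.germ N.1 x hN).hom := by
    intro U N hN h
    rw [← J.map_ideal h, Ideal.map_map, ← CommRingCat.hom_comp]
    congr 2
    exact (X.presheaf.germ_res (homOfLE h) x hN).symm
  obtain ⟨_, ⟨N, hN, rfl⟩, hxN, hNUV⟩ := X.isBasis_affineOpens.exists_subset_of_mem_open
    (show x ∈ U.1 ⊓ V.1 from ⟨hU, hV⟩) (U.1 ⊓ V.1).2
  exact (key U ⟨N, hN⟩ hxN (hNUV.trans inf_le_left)).trans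
    (key V ⟨N, hN⟩ hxN (hNUV.trans inf_le_right)).symm

theorem stalkIdeal_eq_map {X : Scheme.{u}} (J : X.IdealSheafData) {x : X} (U : X.affineOpens)
    (hU : x ∈ U.1) : stalkIdeal J x = (J.ideal U).map (X.presheaf.germ U.1 x hU).hom :=
  le_antisymm (iSup₂_le fun V hV => (map_germ_ideal_eq J V U hV hU).le)
    (le_iSup₂_of_le U hU le_rfl)

theorem ideal_prod_pow {X : Scheme.{u}} {ι : Type*} (s : Finset ι) (J : ι → X.IdealSheafData)
    (b : ι → ℕ) (U : X.affineOpens) :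
    (∏ i ∈ s, J i ^ b i).ideal U = ∏ i ∈ s, (J i).ideal U ^ b i := by
  classical
  induction s using Finset.induction_on with
  | empty =>
    rw [Finset.prod_empty, Finset.prod_empty, Scheme.IdealSheafData.one_eq_top, Ideal.one_eq_top]
    rfl
  | insert i s hi ih => simp [Finset.prod_insert hi, ← ih]

theorem map_ideal_le_ideal_comap {X Y : Scheme.{u}} (I : Y.IdealSheafData) (f : X ⟶ Y)
    (V : Y.affineOpens) (U : X.affineOpens) (h : U.1 ≤ f ⁻¹ᵁ V.1) :
    (I.ideal V).map (f.appLE V.1 U.1 h).hom ≤ (I.comap f).ideal U := by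
  rw [Ideal.map_le_iff_le_comap]
  intro s hs
  have h2 : s ∈ RingHom.ker (((I.comap f).subschemeι ≫ f).app V.1).hom :=
    Scheme.Hom.ideal_ker_le _ V (I.le_map_comap f V hs)
  rw [Ideal.mem_comap, ← (I.comap f).ker_subschemeι_app U, RingHom.mem_ker]
  have h3 : f.appLE V.1 U.1 h ≫ (I.comap f).subschemeι.app U.1 =
      ((I.comap f).subschemeι ≫ f).app V.1 ≫ (I.comap f).subscheme.presheaf.map
        (homOfLE ((I.comap f).subschemeι.preimage_mono h)).op := by
    simp [Scheme.Hom.appLE]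
  rw [← CommRingCat.comp_apply, h3, CommRingCat.comp_apply, (RingHom.mem_ker).mp h2, map_zero]

/-- By the adjunction between `comap` and `map`, it suffices that the ideal generated by the pulled
back sections contracts to one containing $I$. -/
theorem ideal_comap_top_le {X Y : Scheme.{u}} [IsAffine X] [IsAffine Y] (I : Y.IdealSheafData)
    (f : X ⟶ Y) :
    (I.comap f).ideal ⟨⊤, isAffineOpen_top X⟩ ≤
      (I.ideal ⟨⊤, isAffineOpen_top Y⟩).map f.appTop.hom := by
  have h : I.comap f ≤
      .ofIdealTop ((I.ideal ⟨⊤, isAffineOpen_top Y⟩).map f.appTop.hom) := by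
    rw [← Scheme.IdealSheafData.le_map_iff_comap_le]
    apply Scheme.IdealSheafData.le_of_isAffine
    rw [Scheme.IdealSheafData.ideal_map_of_isAffineHom, ← Ideal.map_le_iff_le_comap]
    intro s hs
    simpa using! hs
  simpa using h ⟨⊤, isAffineOpen_top X⟩

theorem ideal_comap_top_le_of_isOpenImmersion {X Y : Scheme.{u}} [IsAffine X]
    (I : Y.IdealSheafData) (f : X ⟶ Y) [IsOpenImmersion f] (V : Y.affineOpens)
    (hV : f ''ᵁ ⊤ = V.1) (h : ⊤ ≤ f ⁻¹ᵁ V.1) :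
    (I.comap f).ideal ⟨⊤, isAffineOpen_top X⟩ ≤ (I.ideal V).map (f.appLE V.1 ⊤ h).hom := by
  obtain ⟨V, hVa⟩ := V
  subst hV
  rw [Scheme.IdealSheafData.ideal_comap_of_isOpenImmersion]
  intro x hx
  have : x = (f.appLE (f ''ᵁ ⊤) ⊤ h).hom ((f.appIso ⊤).inv.hom x) := by
    rw [← Scheme.Hom.appIso_hom', ← CommRingCat.comp_apply, Iso.inv_hom_id]
    rfl
  rw [this]
  exact Ideal.mem_map_of_mem _ hx

theorem isIso_appLE_top {X Y : Scheme.{u}} (f : X ⟶ Y) [IsOpenImmersion f] (V : Y.Opens)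
    (hV : f ''ᵁ ⊤ = V) (h : ⊤ ≤ f ⁻¹ᵁ V) : IsIso (f.appLE V ⊤ h) := by
  subst hV
  rw [← Scheme.Hom.appIso_hom']
  infer_instance

/-- Reduces to the affine case: `fromSpec` identifies both charts with spectra, and the resulting
isomorphism on sections of `U` is cancelled at the end. -/
theorem ideal_comap_le_map_ideal {X Y : Scheme.{u}} (I : Y.IdealSheafData) (f : X ⟶ Y)
    (V : Y.affineOpens) (U : X.affineOpens) (h : U.1 ≤ f ⁻¹ᵁ V.1) :
    (I.comap f).ideal U ≤ (I.ideal V).map (f.appLE V.1 U.1 h).hom := by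
  obtain ⟨V, hV⟩ := V
  obtain ⟨U, hU⟩ := U
  change IsAffineOpen V at hV
  change IsAffineOpen U at hU
  have hV' : ⊤ ≤ hV.fromSpec ⁻¹ᵁ V := hV.fromSpec_preimage_self.ge
  have hU' : ⊤ ≤ hU.fromSpec ⁻¹ᵁ U := hU.fromSpec_preimage_self.ge
  have hVi : hV.fromSpec ''ᵁ ⊤ = V := by simp
  have hUi : hU.fromSpec ''ᵁ ⊤ = U := by simp
  have hsq : Spec.map (f.appLE V U h) ≫ hV.fromSpec = hU.fromSpec ≫ f :=
    IsAffineOpen.SpecMap_appLE_fromSpec f hV hU h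
  have h1 := map_ideal_le_ideal_comap (I.comap f) hU.fromSpec ⟨U, hU⟩ ⟨⊤, isAffineOpen_top _⟩ hU'
  rw [← Scheme.IdealSheafData.comap_comp, ← hsq, Scheme.IdealSheafData.comap_comp] at h1
  have h2 := h1.trans ((ideal_comap_top_le _ _).trans (Ideal.map_mono
    (ideal_comap_top_le_of_isOpenImmersion I hV.fromSpec ⟨V, hV⟩ hVi hV')))
  have h3 : hV.fromSpec.appLE V ⊤ hV' ≫ (Spec.map (f.appLE V U h)).appTop =
      f.appLE V U h ≫ hU.fromSpec.appLE U ⊤ hU' := by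
    have htop : ⊤ ≤ Spec.map (f.appLE V U h) ⁻¹ᵁ ⊤ := (Scheme.Hom.preimage_top _).ge
    have h4 : (Spec.map (f.appLE V U h)).appTop = (Spec.map (f.appLE V U h)).appLE ⊤ ⊤ htop :=
      Scheme.Hom.app_eq_appLE _
    rw [h4]
    refine (Scheme.Hom.appLE_comp_appLE ..).trans (Eq.trans ?_
      (Scheme.Hom.appLE_comp_appLE ..).symm)
    simp only [hsq]
  rw [Ideal.map_map, ← CommRingCat.hom_comp, h3, CommRingCat.hom_comp, ← Ideal.map_map] at h2
  have := isIso_appLE_top hU.fromSpec U hUi hU'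
  have hbij : Function.Bijective (hU.fromSpec.appLE U ⊤ hU').hom :=
    ConcreteCategory.bijective_of_isIso _
  rw [Ideal.map_le_iff_le_comap, Ideal.comap_map_of_bijective _ hbij] at h2
  exact h2

end IdealSheaves

/-! ### Lifting generic points along a birational morphism. -/

section GenericPoint

theorem SpecMap_germ_comp_fromSpec {X : Scheme.{u}} {U : X.Opens} (hU : IsAffineOpen U) {x : X}
    (hx : x ∈ U) {R : CommRingCat.{u}} (φ : X.presheaf.stalk x ⟶ R) :
    Spec.map (X.presheaf.germ U x hx ≫ φ) ≫ hU.fromSpec = Spec.map φ ≫ X.fromSpecStalk x := by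
  rw [← hU.fromSpecStalk_eq_fromSpecStalk hx, IsAffineOpen.fromSpecStalk, Spec.map_comp,
    Category.assoc]

/-- On a locally Noetherian scheme, every dense open contains the generic points of the integral
local schemes. -/
theorem fromSpecStalk_mem_of_dense {W : Scheme.{u}} [IsLocallyNoetherian W] (x : W)
    {K : Type u} [Field K] (φ : W.presheaf.stalk x ⟶ .of K) (hφ : Function.Injective φ.hom)
    {U : W.Opens} (hU : Dense (U : Set W)) (z : Spec (.of K)) :
    (Spec.map φ ≫ W.fromSpecStalk x) z ∈ U := by
  obtain ⟨_, ⟨V, hV, rfl⟩, hxV, -⟩ :=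
    W.isBasis_affineOpens.exists_subset_of_mem_open (Set.mem_univ x) isOpen_univ
  change IsAffineOpen V at hV
  have : IsNoetherianRing Γ(W, V) := IsLocallyNoetherian.component_noetherian ⟨V, hV⟩
  -- The kernel of the germ map is finitely generated, so all of it dies at every point near $x$, in
  -- particular at some $y\in U$. As `φ` is injective, the image of `z` corresponds to this kernel;
  -- it therefore specializes to $y$ and lies in the open set $U$.
  obtain ⟨t, ht⟩ := IsNoetherian.noetherian (RingHom.ker (W.presheaf.germ V x hxV).hom)
  have hnhds : ∀ᶠ y in nhds x, ∀ a ∈ t, ∀ hy : y ∈ V, W.presheaf.germ V y hy a = 0 := by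
    rw [Filter.eventually_all_finset]
    intro a ha
    have ha0 : W.presheaf.germ V x hxV a = W.presheaf.germ V x hxV 0 := by
      rw [map_zero]
      exact (ht ▸ Ideal.subset_span ha : a ∈ RingHom.ker (W.presheaf.germ V x hxV).hom)
    obtain ⟨N, hxN, i₁, i₂, h⟩ := W.presheaf.germ_eq x hxV hxV a 0 ha0
    filter_upwards [N.2.mem_nhds hxN] with y hyN hyV
    rw [← W.presheaf.germ_res_apply i₁ y hyN, h, map_zero, map_zero]
  obtain ⟨y, hyU, hy, hyV⟩ := hU.inter_nhds_nonempty
    (Filter.inter_mem hnhds (V.2.mem_nhds hxV))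
  have hker : RingHom.ker (W.presheaf.germ V x hxV).hom ≤
      RingHom.ker (W.presheaf.germ V y hyV).hom := by
    rw [← ht]
    exact Ideal.span_le.mpr fun a ha => hy a ha hyV
  refine Specializes.mem_open ?_ U.2 hyU
  have hz : (Spec.map φ ≫ W.fromSpecStalk x) z =
      hV.fromSpec (Spec.map (W.presheaf.germ V x hxV ≫ φ) z) := by
    rw [← SpecMap_germ_comp_fromSpec hV hxV]
    rfl
  have hy' : hV.fromSpec (hV.primeIdealOf ⟨y, hyV⟩) = y := hV.fromSpec_primeIdealOf ⟨y, hyV⟩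
  rw [hz, ← hy']
  refine Specializes.map ?_ hV.fromSpec.continuous
  rw [hV.primeIdealOf_eq_map_closedPoint]
  refine (PrimeSpectrum.le_iff_specializes _ _).mp ?_
  intro a ha
  have ha' : φ.hom (W.presheaf.germ V x hxV a) ∈ z.asIdeal := ha
  have ha0 : φ.hom (W.presheaf.germ V x hxV a) = 0 := by
    by_contra h
    exact z.isPrime.ne_top (Ideal.eq_top_of_isUnit_mem _ ha' (isUnit_iff_ne_zero.mpr h))
  have hax : a ∈ RingHom.ker (W.presheaf.germ V x hxV).hom := hφ (ha0.trans (map_zero φ.hom).symm)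
  change (W.presheaf.germ V y hyV) a ∈ IsLocalRing.maximalIdeal _
  have hay : W.presheaf.germ V y hyV a = 0 := hker hax
  rw [hay]
  exact zero_mem _

theorem exists_lift_of_birationalOver {W' W : Scheme.{u}} [IsLocallyNoetherian W] {π : W' ⟶ W}
    (h : Scheme.BirationalOver π (𝟙 W)) (x : W) {K : Type u} [Field K]
    (φ : W.presheaf.stalk x ⟶ .of K) (hφ : Function.Injective φ.hom) :
    ∃ l : Spec (.of K) ⟶ W', l ≫ π = Spec.map φ ≫ W.fromSpecStalk x := by
  obtain ⟨e, he⟩ := h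
  set g := Spec.map φ ≫ W.fromSpecStalk x with hg
  have hrange : Set.range g ⊆ Set.range e.target.ι := by
    rintro _ ⟨z, rfl⟩
    rw [Scheme.Opens.range_ι]
    exact fromSpecStalk_mem_of_dense x φ hφ e.dense_target z
  refine ⟨IsOpenImmersion.lift e.target.ι g hrange ≫ e.iso.inv ≫ e.source.ι, ?_⟩
  have he' : e.source.ι ≫ π = e.iso.hom ≫ e.target.ι := by
    rw [← he, Category.comp_id]
  simp [he']

end GenericPoint

/-! ### The two inclusions. -/

section Contraction

variable {W' W : Scheme.{u}} {π : W' ⟶ W}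

/-- A function whose pullback to `W'` lies in `I 𝒪_{W'}` is integral over `I`, if `W' ⟶ W` is
proper and birational. -/
theorem contraction_comap_le_integralClosure [IsLocallyNoetherian W] [IsProper π]
    (h : Scheme.BirationalOver π (𝟙 W)) (hW : ∀ x : W, IsDomain (W.presheaf.stalk x))
    (I : W.IdealSheafData) : contraction (I.comap π) π ≤ integralClosure I := by
  rintro ⟨V, hV⟩ f hf
  change IsAffineOpen V at hV
  refine hV.mem_ideal_iff.mpr fun x hx => ?_
  let : Algebra Γ(W, V) (W.presheaf.stalk x) := (W.presheaf.germ V x hx).hom.toAlgebra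
  have : IsLocalization.AtPrime (W.presheaf.stalk x) (hV.primeIdealOf ⟨x, hx⟩).asIdeal :=
    hV.isLocalization_stalk ⟨x, hx⟩
  change algebraMap Γ(W, V) (W.presheaf.stalk x) f ∈
    (integralClosureIdeal (I.ideal ⟨V, hV⟩)).map (algebraMap Γ(W, V) (W.presheaf.stalk x))
  -- Integral closure commutes with localization, so the question moves to the local ring at $x$.
  rw [map_integralClosureIdeal (hV.primeIdealOf ⟨x, hx⟩).asIdeal.primeCompl]
  have := hW x
  let K := FractionRing (W.presheaf.stalk x)
  refine isIntegralOverIdeal_of_forall_valuationSubring (K := K) _ _ fun O ρ hρ => ?_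
  obtain ⟨l, hl⟩ := exists_lift_of_birationalOver h x (CommRingCat.ofHom (algebraMap (W.presheaf.stalk x) K))
    (IsFractionRing.injective _ _)
  let S : ValuativeCommSq π :=
    { R := O
      K := K
      i₁ := l
      i₂ := Spec.map (CommRingCat.ofHom ρ) ≫ W.fromSpecStalk x
      commSq := ⟨by
        rw [hl, ← Spec.map_comp_assoc, ← CommRingCat.ofHom_comp]
        congr 3
        exact hρ.symm⟩ }
  have hex : ValuativeCriterion.Existence π := by
    have : UniversallyClosed π := inferInstance
    rw [UniversallyClosed.eq_valuativeCriterion] at this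
    exact this.1
  obtain ⟨⟨g, -, hg⟩⟩ := (hex S).exists_lift
  change Spec (.of O) ⟶ W' at g
  change g ≫ π = Spec.map (CommRingCat.ofHom ρ) ≫ W.fromSpecStalk x at hg
  set y := g (IsLocalRing.closedPoint O) with hy
  -- `ρ` need not be local, so $\pi(y)$ is only a generalization of $x$; this suffices because $V$
  -- is open.
  have hyV : y ∈ π ⁻¹ᵁ V := by
    have h1 : π y = W.fromSpecStalk x (Spec.map (CommRingCat.ofHom ρ)
        (IsLocalRing.closedPoint O)) := congr($hg (IsLocalRing.closedPoint O))
    have h2 : π y ∈ Set.range (W.fromSpecStalk x) := ⟨_, h1.symm⟩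
    rw [Scheme.range_fromSpecStalk] at h2
    exact Specializes.mem_open (x := π y) h2 V.2 hx
  obtain ⟨_, ⟨U, hU, rfl⟩, hyU, hUV⟩ := W'.isBasis_affineOpens.exists_subset_of_mem_open
    hyV (π ⁻¹ᵁ V).2
  change IsAffineOpen U at hU
  change U ≤ π ⁻¹ᵁ V at hUV
  let ψ : Γ(W', U) ⟶ .of O := W'.presheaf.germ U y hyU ≫ Scheme.stalkClosedPointTo g
  have hψ : Spec.map ψ ≫ hU.fromSpec = g := by
    rw [SpecMap_germ_comp_fromSpec]
    exact Scheme.Spec_stalkClosedPointTo_fromSpecStalk g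
  -- Both routes from $\Gamma(W,V)$ to $O$ agree, so $f\in\mathcal I\mathcal O_{W'}$ on $U$
  -- transfers to membership in the extension of $\mathcal I$ to $O$.
  have hcomp : π.appLE V U hUV ≫ ψ = W.presheaf.germ V x hx ≫ CommRingCat.ofHom ρ := by
    apply Spec.map_injective
    rw [← cancel_mono hV.fromSpec]
    refine Eq.trans ?_ (SpecMap_germ_comp_fromSpec hV hx (CommRingCat.ofHom ρ)).symm
    rw [Spec.map_comp, Category.assoc,
      IsAffineOpen.SpecMap_appLE_fromSpec π hV hU hUV, reassoc_of% hψ, hg]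
    rfl
  have h1 := ideal_comap_le_map_ideal I π ⟨V, hV⟩ ⟨U, hU⟩ hUV
    ((mem_contraction_iff _ π ⟨V, hV⟩ f).mp hf ⟨U, hU⟩ hUV)
  have h2 := Ideal.mem_map_of_mem ψ.hom h1
  rw [Ideal.map_map, ← CommRingCat.hom_comp, ← CommRingCat.comp_apply, hcomp] at h2
  rw [Ideal.map_map]
  exact h2

/-- Off $Z$, some section of the ideal is a unit in the stalk. -/
theorem stalkIdeal_vanishingIdeal_of_notMem {X : Scheme.{u}} {Z : Closeds X} {y : X}
    (hy : y ∉ Z) : stalkIdeal (Scheme.IdealSheafData.vanishingIdeal Z) y = ⊤ := by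
  obtain ⟨_, ⟨U, hU, rfl⟩, hyU, -⟩ :=
    X.isBasis_affineOpens.exists_subset_of_mem_open (Set.mem_univ y) isOpen_univ
  have hy' : y ∉ (Scheme.IdealSheafData.vanishingIdeal Z).support := by
    rwa [← SetLike.mem_coe, Scheme.IdealSheafData.coe_support_vanishingIdeal]
  rw [Scheme.IdealSheafData.mem_support_iff_of_mem (U := ⟨U, hU⟩) hyU,
    Scheme.mem_zeroLocus_iff] at hy'
  push Not at hy'
  obtain ⟨f, hf, hyf⟩ := hy'
  rw [stalkIdeal_eq_map _ ⟨U, hU⟩ hyU]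
  exact Ideal.eq_top_of_isUnit_mem _ (Ideal.mem_map_of_mem _ hf)
    ((X.mem_basicOpen f y hyU).mp hyf)

/-- If the pullback of `I` lies in an ideal sheaf `J` supported on a simple normal crossings
divisor, then the contraction of `J` contains the integral closure of `I`. -/
theorem integralClosure_le_contraction_prod [QuasiCompact π] {r : ℕ} {H : Fin r → Closeds W'}
    (hns : ∀ y : W', IsRegularLocalRing (W'.presheaf.stalk y)) (hH : IsSimpleNormalCrossings H)
    (b : Fin r → ℕ) (I : W.IdealSheafData)
    (hI : I.comap π ≤ ∏ i, Scheme.IdealSheafData.vanishingIdeal (H i) ^ b i) :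
    integralClosure I ≤
      contraction (∏ i, Scheme.IdealSheafData.vanishingIdeal (H i) ^ b i) π := by
  intro V f hf
  refine (mem_contraction_iff _ π V f).mpr fun U hUV => ?_
  have hUa : IsAffineOpen U.1 := U.2
  refine hUa.mem_ideal_iff.mpr fun y hy => ?_
  have h1 : ∀ i, ((Scheme.IdealSheafData.vanishingIdeal (H i)).ideal U).map
      (W'.presheaf.germ U.1 y hy).hom =
        stalkIdeal (Scheme.IdealSheafData.vanishingIdeal (H i)) y := fun i =>
    (stalkIdeal_eq_map _ U hy).symm
  have := hns y
  obtain ⟨n, t, c, ht, -, hc⟩ := hH.normalCrossings y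
  have := ht.isDomain
  have hf' : IsIntegralOverIdeal (((∏ i, Scheme.IdealSheafData.vanishingIdeal (H i) ^ b i).ideal
      U).map (W'.presheaf.germ U.1 y hy).hom)
      ((W'.presheaf.germ U.1 y hy).hom ((π.appLE V.1 U.1 hUV).hom f)) :=
    IsIntegralOverIdeal.map _ le_rfl (IsIntegralOverIdeal.map _
      ((map_ideal_le_ideal_comap I π V U hUV).trans (hI U)) hf)
  -- Extension to the stalk is multiplicative, so the total transform becomes a product of principal
  -- prime powers and unit ideals.
  have h2 : ((∏ i, Scheme.IdealSheafData.vanishingIdeal (H i) ^ b i).ideal U).map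
      (W'.presheaf.germ U.1 y hy).hom =
        ∏ i, stalkIdeal (Scheme.IdealSheafData.vanishingIdeal (H i)) y ^ b i := by
    rw [ideal_prod_pow]
    refine (map_prod (Ideal.mapHom _) _ _).trans (Finset.prod_congr rfl fun i _ => ?_)
    exact (Ideal.map_pow _ _ _).trans (congrArg (· ^ b i) (h1 i))
  rw [h2] at hf' ⊢
  refine hf'.mem_prod _ _ _ fun i => ?_
  by_cases hi : y ∈ H i
  · exact Or.inr ⟨t (c ⟨i, hi⟩), ht.prime _, hc ⟨i, hi⟩⟩
  · exact Or.inl (stalkIdeal_vanishingIdeal_of_notMem hi)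

theorem ideal_comap_eq_map {X Y : Scheme.{u}} (I : Y.IdealSheafData) (f : X ⟶ Y)
    (V : Y.affineOpens) (U : X.affineOpens) (h : U.1 ≤ f ⁻¹ᵁ V.1) :
    (I.comap f).ideal U = (I.ideal V).map (f.appLE V.1 U.1 h).hom :=
  le_antisymm (ideal_comap_le_map_ideal I f V U h) (map_ideal_le_ideal_comap I f V U h)

/-- On affine charts mapping into affine charts, inverse image is extension of ideals, which
commutes with powers. -/
theorem comap_pow (π : W' ⟶ W) (I : W.IdealSheafData) (m : ℕ) :
    (I ^ m).comap π = I.comap π ^ m := by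
  have hex : ∀ y : W', ∃ (U : W'.affineOpens) (V : W.affineOpens), y ∈ U.1 ∧
      U.1 ≤ π ⁻¹ᵁ V.1 := by
    intro y
    obtain ⟨_, ⟨V, hV, rfl⟩, hyV, -⟩ :=
      W.isBasis_affineOpens.exists_subset_of_mem_open (Set.mem_univ (π y)) isOpen_univ
    obtain ⟨_, ⟨U, hU, rfl⟩, hyU, hUV⟩ := W'.isBasis_affineOpens.exists_subset_of_mem_open
      (show y ∈ π ⁻¹ᵁ V from hyV) (π ⁻¹ᵁ V).2
    exact ⟨⟨U, hU⟩, ⟨V, hV⟩, hyU, hUV⟩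
  choose U V hy hUV using hex
  refine Scheme.IdealSheafData.ext_of_iSup_eq_top U ?_ fun y => ?_
  · exact top_le_iff.mp fun y _ => Opens.mem_iSup.mpr ⟨y, hy y⟩
  · rw [Scheme.IdealSheafData.ideal_pow, Pi.pow_apply, ideal_comap_eq_map _ π (V y) (U y) (hUV y),
      ideal_comap_eq_map _ π (V y) (U y) (hUV y), Scheme.IdealSheafData.ideal_pow, Pi.pow_apply,
      Ideal.map_pow]

end Contraction

end LogRes

/-! ### Conclusion. -/

theorem mainTheorem6 (k : Type u) [Field k] [CharZero k]
    (W : Scheme.{u}) (p : W ⟶ Spec (CommRingCat.of k))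
    [IsSeparated p] [LocallyOfFiniteType p] [QuasiCompact p]
    (hW : LogRes.IsNonsingular W) (I : W.IdealSheafData)
    (W' : Scheme.{u}) (π : W' ⟶ W) (r : ℕ) (H : Fin r → Closeds W') (a : Fin r → ℕ)
    (hπ : LogRes.IsLogResolution π I H a) (m : ℕ) (hm : 1 ≤ m) :
    LogRes.integralClosure (I ^ m) =
      LogRes.contraction (∏ i, Scheme.IdealSheafData.vanishingIdeal (H i) ^ (m * a i)) π := by
  have hW' : IsLocallyNoetherian W := LocallyOfFiniteType.isLocallyNoetherian p
  have := hπ.isProper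
  have hcomap : (I ^ m).comap π =
      ∏ i, Scheme.IdealSheafData.vanishingIdeal (H i) ^ (m * a i) := by
    rw [LogRes.comap_pow, hπ.totalTransform, ← Finset.prod_pow]
    exact Finset.prod_congr rfl fun i _ => by rw [← pow_mul, mul_comm]
  refine le_antisymm (LogRes.integralClosure_le_contraction_prod hπ.isNonsingular
    hπ.isSimpleNormalCrossings _ _ hcomap.le) ?_
  rw [← hcomap]
  refine LogRes.contraction_comap_le_integralClosure hπ.birational (fun x => ?_) _
  have := hW x
  exact LogRes.isDomain_of_isRegularLocalRing _
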